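/- **Proposition 2.5.** Let $A=\{0,1,\dots,d\}$ with $d\ge 1$, let $X\subset\mathbb R$ be compact and connected, and let $f_a:X\to\operatorname{Int}X$ $(a\in A)$ be strictly increasing contractions such that the sets $f_a(X)$ are pairwise disjoint, $f_0(X)$ being the leftmost and $f_1(X)$ the rightmost of them. Assume that for some $\epsilon>0$ and some open interval $Y\supset X$ each $f_a$ has a $C^{1+\epsilon}$ continuation to $Y$ which maps $Y$ into $Y$ and is a diffeomorphism onto its image. Write $f_\omega=f_{x_1}\circ\dots\circ f_{x_n}$ for $\omega=x_1\dots x_n\in A^n$, and let $\mathcal L=\bigcap_{n}\bigcup_{\omega\in A^n}f_\omega(X)$ be the limit set. Identify $\xi\in\mathcal L$ with its code $(x_1x_2\dots)\in A^{\mathbb N}$, the unique infinite word with $\{\xi\}=\bigcap_n f_{x_1\dots x_n}(X)$; let $\sigma$ be the left shift, $S_ng=\sum_{k=0}^{n-1}g\circ\sigma^k$, let $[\omega]\subset\mathcal L$ be the set of points whose code begins with $\omega$, and let $\underline i=(iii\dots)$. Let $\phi(\xi)=\log f_{x_1}'(\sigma\xi)$ be the geometric potential. Let $\alpha>0$ and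 let $\psi:\mathcal L\to\mathbb R$ be Hölder continuous with $\alpha\phi<\psi<0$ and $$P(\psi)=\lim_{n\to\infty}\frac1n\log\sum_{\omega\in A^n}\exp\Big(\sup_{\xi\in[\omega]}S_n\psi(\xi)\Big)=0,$$ and put $\chi_\alpha=\psi-\alpha\phi$. Let $\nu_\psi$ be a Gibbs measure for $\psi$, that is, a Borel probability measure with $\nu_\psi(\mathcal L)=1$ for which there is $c>0$ with $c^{-1}e^{S_n\psi(\xi)}\le\nu_\psi([\omega])\le c\,e^{S_n\psi(\xi)}$ for all $n$, all $\omega\in A^n$ and all $\xi\in[\omega]$. Let $F_\psi(x)=\nu_\psi((-\infty,x])$. Let $\xi=(x_1x_2\dots)\in\mathcal L$ be a point whose code is neither eventually constantly $0$ nor eventually constantly $1$. For $i\in\{0,1\}$ and $n,k\ge1$, say that $\xi$ has an $i$-block of length $k$ at the $n$-th level if $x_n\ne i$, $x_{n+1}=\dots=x_{n+k}=i$ and $x_{n+k+1}\neq i$. Then the limit $$(D^\alpha F_\psi)(\xi)=\lim_{\eta\to\xi}\frac{|F_\psi(\xi)-F_\psi(\eta)|}{|\xi-\eta|^\alpha}$$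 fails to exist in the generalized sense (that is, it exists neither as a finite number nor as $\infty$) if and only if there are $i\in\{0,1\}$ and strictly increasing sequences $(n_m)$, $(k_m)$ of positive integers such that, for every $m$, $\xi$ has an $i$-block of length $k_m$ at the $n_m$-th level, and the sequence $$\exp\big(S_{n_m}\chi_\alpha(\xi)+k_m\,\psi(\underline i)\big)$$ is bounded. -/

import Mathlib

open MeasureTheory Filter Topology Set
open scoped NNReal

/-- A conformal iterated function system on the line with alphabet `{0, 1, …, d + 1}`
(at least two letters).  Only the values of `f a` on `X` are relevant.

The maps are orientation preserving, so that the logarithm of the derivative makes sense. -/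
structure ConformalIFS (d : ℕ) where
  X : Set ℝ
  f : Fin (d + 2) → ℝ → ℝ
  isCompact_X : IsCompact X
  isConnected_X : IsConnected X
  mapsTo_interior : ∀ a, MapsTo (f a) X (interior X)
  contraction : ∀ a, ∃ K : ℝ≥0, K < 1 ∧ LipschitzOnWith K (f a) X
  strictMono : ∀ a, StrictMonoOn (f a) X
  /-- Strong separation (the inclusion `f a (int X) ⊆ int X` is part of `mapsTo_interior`). -/
  separation : ∀ a b, a ≠ b → Disjoint (f a '' X) (f b '' X)
  /-- Each `f a` has a `C^{1+ε}` continuation to an open interval `Y ⊇ X` which maps `Y` into `Y`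
  and is a diffeomorphism onto its image. -/
  holder : ∃ ε : ℝ≥0, 0 < ε ∧ ∃ Y : Set ℝ, IsOpen Y ∧ Y.OrdConnected ∧ X ⊆ Y ∧
    ∀ a, ∃ g : ℝ → ℝ, EqOn g (f a) X ∧ MapsTo g Y Y ∧ InjOn g Y ∧ DifferentiableOn ℝ g Y ∧
      (∀ y ∈ Y, deriv g y ≠ 0) ∧ ∃ C : ℝ≥0, HolderOnWith C ε (deriv g) Y
  /-- The letter `0` labels the leftmost interval of the first level. -/
  leftmost : ∀ a, a ≠ 0 → ∀ u ∈ f 0 '' X, ∀ v ∈ f a '' X, u < v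
  /-- The letter `1` labels the rightmost interval of the first level. -/
  rightmost : ∀ a, a ≠ 1 → ∀ u ∈ f 1 '' X, ∀ v ∈ f a '' X, v < u

namespace ConformalIFS

variable {d : ℕ} (F : ConformalIFS d)

/-- `F.comp n ω = f_{ω_1} ∘ ⋯ ∘ f_{ω_n}`. -/
def comp : (n : ℕ) → (Fin n → Fin (d + 2)) → ℝ → ℝ
  | 0, _ => id
  | n + 1, ω => F.f (ω 0) ∘ comp n (Fin.tail ω)

/-- The first `n` letters of an infinite word. Words are indexed from `0`: the letter `x_j` of the
usual notation `x_1 x_2 x_3 …` is `x (j - 1)`. -/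
def pre (x : ℕ → Fin (d + 2)) (n : ℕ) : Fin n → Fin (d + 2) := fun j => x j

/-- The limit set `⋂_n ⋃_{ω ∈ A^n} f_ω(X)`. -/
def limitSet : Set ℝ := ⋂ n : ℕ, ⋃ ω : Fin n → Fin (d + 2), F.comp n ω '' F.X

theorem mapsTo_X (a : Fin (d + 2)) : MapsTo (F.f a) F.X F.X :=
  fun _ hy => interior_subset (F.mapsTo_interior a hy)

theorem comp_mapsTo (n : ℕ) (ω : Fin n → Fin (d + 2)) : MapsTo (F.comp n ω) F.X F.X := by
  induction n with
  | zero => exact mapsTo_id _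
  | succ n ih => exact (F.mapsTo_X _).comp (ih _)

theorem comp_pre_succ (x : ℕ → Fin (d + 2)) (n : ℕ) :
    F.comp (n + 1) (pre x (n + 1)) = F.f (x 0) ∘ F.comp n (pre (fun j => x (j + 1)) n) := rfl

theorem exists_lipschitz : ∃ K : ℝ≥0, K < 1 ∧ ∀ a, LipschitzOnWith K (F.f a) F.X := by
  choose K hK hL using F.contraction
  refine ⟨Finset.univ.sup K, ?_, fun a => (hL a).weaken (Finset.le_sup (Finset.mem_univ a))⟩
  rw [Finset.sup_lt_iff (by simp)]
  exact fun a _ => hK a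

theorem comp_lipschitz {K : ℝ≥0} (hK : ∀ a, LipschitzOnWith K (F.f a) F.X) (n : ℕ)
    (ω : Fin n → Fin (d + 2)) : LipschitzOnWith (K ^ n) (F.comp n ω) F.X := by
  induction n with
  | zero => simpa [comp] using LipschitzWith.id.lipschitzOnWith
  | succ n ih =>
    rw [pow_succ']
    exact (hK _).comp (ih _) (F.comp_mapsTo n _)

theorem comp_pre_antitone (x : ℕ → Fin (d + 2)) (n : ℕ) :
    F.comp (n + 1) (pre x (n + 1)) '' F.X ⊆ F.comp n (pre x n) '' F.X := by
  induction n generalizing x with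
  | zero =>
    rintro _ ⟨p, hp, rfl⟩
    exact ⟨_, F.mapsTo_X (x 0) hp, rfl⟩
  | succ n ih =>
    rw [comp_pre_succ, comp_pre_succ _ x n, image_comp, image_comp]
    exact image_mono (ih _)

/-- Every infinite word determines exactly one point of `⋂_n f_{x_1 … x_n}(X)`. -/
theorem existsUnique_point (x : ℕ → Fin (d + 2)) :
    ∃! u : ℝ, ∀ n, u ∈ F.comp n (pre x n) '' F.X := by
  obtain ⟨K, hK1, hK⟩ := F.exists_lipschitz
  have hcont : ∀ n, IsCompact (F.comp n (pre x n) '' F.X) := fun n =>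
    F.isCompact_X.image_of_continuousOn (F.comp_lipschitz hK n _).continuousOn
  obtain ⟨u, hu⟩ := IsCompact.nonempty_iInter_of_sequence_nonempty_isCompact_isClosed
    (fun n => F.comp n (pre x n) '' F.X) (F.comp_pre_antitone x)
    (fun n => F.isConnected_X.nonempty.image _) (hcont 0) (fun n => (hcont n).isClosed)
  refine ⟨u, mem_iInter.1 hu, fun v hv => ?_⟩
  have hbd : ∀ n : ℕ, dist v u ≤ (K : ℝ) ^ n * Metric.diam F.X := by
    intro n
    obtain ⟨p, hp, rfl⟩ := hv n
    obtain ⟨q, hq, hqu⟩ := mem_iInter.1 hu n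
    rw [← hqu]
    refine ((F.comp_lipschitz hK n _).dist_le_mul p hp q hq).trans ?_
    rw [NNReal.coe_pow]
    gcongr
    exact Metric.dist_le_diam_of_mem F.isCompact_X.isBounded hp hq
  have hlim : Tendsto (fun n : ℕ => (K : ℝ) ^ n * Metric.diam F.X) atTop (𝓝 (0 * _)) :=
    (tendsto_pow_atTop_nhds_zero_of_lt_one K.2 (by exact_mod_cast hK1)).mul_const _
  rw [zero_mul] at hlim
  exact dist_le_zero.1 (ge_of_tendsto' hlim hbd)

/-- The coding map on infinite words, with values in `ℝ`. -/
noncomputable def point (x : ℕ → Fin (d + 2)) : ℝ := (F.existsUnique_point x).choose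

theorem point_mem (x : ℕ → Fin (d + 2)) (n : ℕ) : F.point x ∈ F.comp n (pre x n) '' F.X :=
  (F.existsUnique_point x).choose_spec.1 n

theorem eq_point {x : ℕ → Fin (d + 2)} {u : ℝ} (h : ∀ n, u ∈ F.comp n (pre x n) '' F.X) :
    u = F.point x := (F.existsUnique_point x).choose_spec.2 u h

theorem point_mem_X (x : ℕ → Fin (d + 2)) : F.point x ∈ F.X := by
  simpa [comp] using F.point_mem x 0

theorem point_mem_limitSet (x : ℕ → Fin (d + 2)) : F.point x ∈ F.limitSet :=
  mem_iInter.2 fun n => mem_iUnion.2 ⟨_, F.point_mem x n⟩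

theorem point_eq (x : ℕ → Fin (d + 2)) :
    F.point x = F.f (x 0) (F.point fun j => x (j + 1)) := by
  symm
  apply F.eq_point
  intro n
  cases n with
  | zero => simpa [comp] using F.mapsTo_X (x 0) (F.point_mem_X _)
  | succ n =>
    rw [comp_pre_succ, image_comp]
    exact mem_image_of_mem _ (F.point_mem _ n)

theorem point_head {x y : ℕ → Fin (d + 2)} (h : F.point x = F.point y) : x 0 = y 0 := by
  by_contra hne
  have hx : F.point x ∈ F.f (x 0) '' F.X := ⟨_, F.point_mem_X _, (F.point_eq x).symm⟩
  have hy : F.point x ∈ F.f (y 0) '' F.X := ⟨_, F.point_mem_X _, (h.trans (F.point_eq y)).symm⟩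
  exact (Set.disjoint_left.1 (F.separation _ _ hne)) hx hy

theorem point_injective : Function.Injective F.point := by
  intro x y h
  funext n
  induction n generalizing x y with
  | zero => exact F.point_head h
  | succ n ih =>
    have h0 := F.point_head h
    rw [F.point_eq x, F.point_eq y, h0] at h
    exact ih ((F.strictMono (y 0)).injOn (F.point_mem_X _) (F.point_mem_X _) h)

theorem limitSet_subset_X : F.limitSet ⊆ F.X := by
  intro u hu
  obtain ⟨_, p, hp, rfl⟩ := mem_iUnion.1 (mem_iInter.1 hu 0)
  exact hp

theorem exists_preimage {u : ℝ} (hu : u ∈ F.limitSet) :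
    ∃ a, ∃ v ∈ F.limitSet, F.f a v = u := by
  obtain ⟨ω, p, hp, hpu⟩ := mem_iUnion.1 (mem_iInter.1 hu 1)
  refine ⟨ω 0, p, mem_iInter.2 fun n => ?_, hpu⟩
  obtain ⟨ω', q, hq, hqu⟩ := mem_iUnion.1 (mem_iInter.1 hu (n + 1))
  have hmem := F.comp_mapsTo n (Fin.tail ω') hq
  have hqu' : F.f (ω' 0) (F.comp n (Fin.tail ω') q) = u := hqu
  have hpu' : F.f (ω 0) p = u := hpu
  have h0 : ω 0 = ω' 0 := by
    by_contra hne
    exact Set.disjoint_left.1 (F.separation _ _ hne) ⟨p, hp, hpu'⟩ ⟨_, hmem, hqu'⟩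
  rw [h0, ← hqu'] at hpu'
  exact mem_iUnion.2 ⟨_, q, hq, ((F.strictMono _).injOn hp hmem hpu').symm⟩

theorem point_surjective {u : ℝ} (hu : u ∈ F.limitSet) : ∃ x, F.point x = u := by
  choose a T hT hf using fun v : F.limitSet => F.exists_preimage v.2
  let T' : F.limitSet → F.limitSet := fun v => ⟨T v, hT v⟩
  refine ⟨fun n => a (T'^[n] ⟨u, hu⟩), (F.eq_point fun n => ?_).symm⟩
  generalize hv : (⟨u, hu⟩ : F.limitSet) = v
  have huv : u = v := by rw [← hv]
  rw [huv]
  clear hv huv hu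
  induction n generalizing v with
  | zero => simpa [comp] using F.limitSet_subset_X v.2
  | succ n ih =>
    rw [comp_pre_succ, image_comp]
    exact ⟨_, ih (T' v), hf v⟩

/-- The coding bijection `Φ` between infinite words and the limit set. -/
noncomputable def coding : (ℕ → Fin (d + 2)) ≃ F.limitSet :=
  Equiv.ofBijective (fun x => ⟨F.point x, F.point_mem_limitSet x⟩)
    ⟨fun _ _ h => F.point_injective (congrArg Subtype.val h),
      fun u => (F.point_surjective u.2).imp fun _ h => Subtype.ext h⟩

/-- The code of a point of the limit set (indexed from `0`). -/
noncomputable def word (ξ : F.limitSet) : ℕ → Fin (d + 2) := F.coding.symm ξ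

/-- The left shift `σ`, transported to the limit set by the coding map. -/
noncomputable def shift (ξ : F.limitSet) : F.limitSet := F.coding fun n => F.word ξ (n + 1)

/-- The point `i i i …`. -/
noncomputable def constPoint (i : Fin (d + 2)) : F.limitSet := F.coding fun _ => i

/-- The cylinder set `[ω]`. -/
def cylinder {n : ℕ} (ω : Fin n → Fin (d + 2)) : Set F.limitSet :=
  {ξ | ∀ j : Fin n, F.word ξ j = ω j}

/-- The geometric potential `φ(ξ) = log f_{x_1}'(σ ξ)` for `ξ = x_1 x_2 …`. -/
noncomputable def geomPotential (ξ : F.limitSet) : ℝ :=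
  Real.log (deriv (F.f (F.word ξ 0)) (F.shift ξ))

/-- `P(g) = p` for the topological pressure
`P(g) = lim (1/n) log ∑_{ω ∈ A^n} exp (sup_{[ω]} S_n g)`. -/
def HasPressure (g : F.limitSet → ℝ) (p : ℝ) : Prop :=
  Tendsto (fun n : ℕ => (1 / (n : ℝ)) * Real.log (∑ ω : Fin n → Fin (d + 2),
    Real.exp (sSup (birkhoffSum F.shift g n '' F.cylinder ω)))) atTop (𝓝 p)

/-- `ν` is a Gibbs measure for the potential `g` (of zero pressure): a Borel probability measure
carried by the limit set with `ν [ω] ≍ exp (S_n g(ξ))`, uniformly in `n`, `ω ∈ A^n`, `ξ ∈ [ω]`. -/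
def IsGibbsMeasure (g : F.limitSet → ℝ) (ν : Measure ℝ) : Prop :=
  IsProbabilityMeasure ν ∧ ν F.limitSetᶜ = 0 ∧
    ∃ c : ℝ, 0 < c ∧ ∀ (n : ℕ) (ω : Fin n → Fin (d + 2)), ∀ ξ ∈ F.cylinder ω,
      c⁻¹ * Real.exp (birkhoffSum F.shift g n ξ) ≤ ν.real (Subtype.val '' F.cylinder ω) ∧
        ν.real (Subtype.val '' F.cylinder ω) ≤ c * Real.exp (birkhoffSum F.shift g n ξ)

/-- The set of points whose code eventually has only `0`s or eventually has only `1`s. -/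
def endpoints : Set F.limitSet :=
  {ξ | ∃ i : Fin (d + 2), (i = 0 ∨ i = 1) ∧ ∃ n : ℕ, ∀ k ≥ n, F.word ξ k = i}

/-- `ξ = x_1 x_2 …` has an `i`-block of length `k` at the `n`-th level (`n, k ≥ 1`):
`x_n ≠ i`, `x_{n+1} = ⋯ = x_{n+k} = i`, `x_{n+k+1} ≠ i`. As codes are indexed from `0`, the letter
`x_j` is `F.word ξ (j - 1)`. -/
def HasBlock (ξ : F.limitSet) (i : Fin (d + 2)) (k n : ℕ) : Prop :=
  1 ≤ n ∧ 1 ≤ k ∧ F.word ξ (n - 1) ≠ i ∧ (∀ m < k, F.word ξ (n + m) = i) ∧ F.word ξ (n + k) ≠ i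

end ConformalIFS

/-- The `α`-Hölder derivative `lim_{η → u} |G u - G η| / |u - η| ^ α` exists in the generalized
sense, that is, as a finite number or as infinity. -/
def HolderDerivExists (α : ℝ) (G : ℝ → ℝ) (u : ℝ) : Prop :=
  ∃ l : EReal, Tendsto (fun η : ℝ => ((|G u - G η| / |u - η| ^ α : ℝ) : EReal)) (𝓝[≠] u) (𝓝 l)

/-! ### Symbolic coding, Birkhoff sums and level intervals -/

namespace ConformalIFS

variable {d : ℕ} (F : ConformalIFS d)

/-! Write `χ = ψ - αφ`. Fix a side of `ξ`, let `i` be the extreme letter on that side, and let `η`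
on that side lie in the `n`-th level interval around `ξ` but not strictly inside the next one. If a
run of exactly `k` letters `i` follows `x_{n+1}`, the cylinder `x_1 … x_{n+1} i^{k+1}` lies between
`η` and `ξ`, while bounded distortion makes `|ξ - η|` at most of order `exp (S_{n+1} φ)`. So the
difference quotient is at least a constant times `exp (S_{n+1} χ + k ψ(iii…))`
(`exists_le_quotient`). If moreover `x_{n+1} ≠ i`, there is a gap next to the level `n+1` interval,
and a suitable `η` in it sees no mass outside `x_1 … x_{n+1} i^k`; this gives the matching upper
bound (`exists_quotient_le`).

Since `χ` is continuous and positive, `S_n χ` grows at least linearly. Ends of level intervals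
followed by no run then give unbounded quotients (`exists_unbounded_quotient`), so `∞` is the only
possible generalized limit, and it fails exactly when quotients stay bounded along some sequence,
which may be taken on one side. The lower bound turns such a sequence into runs with bounded
exponent; the growth of `S_n χ` forces these to be long, and extending them backwards to maximal
blocks only lowers the exponent (`exists_block`). Conversely, blocks with bounded exponent give
bounded quotients by the upper bound. -/

theorem word_coding (x : ℕ → Fin (d + 2)) : F.word (F.coding x) = x :=
  F.coding.symm_apply_apply x

theorem shift_coding (x : ℕ → Fin (d + 2)) :
    F.shift (F.coding x) = F.coding (fun j => x (j + 1)) := by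
  simp only [shift, word_coding]

theorem shift_iterate_coding (n : ℕ) (x : ℕ → Fin (d + 2)) :
    F.shift^[n] (F.coding x) = F.coding (fun j => x (j + n)) := by
  induction n generalizing x with
  | zero => rfl
  | succ n ih =>
    rw [Function.iterate_succ_apply, shift_coding, ih]
    simp only [add_assoc]

theorem birkhoffSum_coding_succ (g : F.limitSet → ℝ) (n : ℕ) (x : ℕ → Fin (d + 2)) :
    birkhoffSum F.shift g (n + 1) (F.coding x) =
      g (F.coding x) + birkhoffSum F.shift g n (F.coding fun j => x (j + 1)) := by
  rw [birkhoffSum_succ', shift_coding]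

theorem birkhoffSum_const (g : F.limitSet → ℝ) (n : ℕ) (i : Fin (d + 2)) :
    birkhoffSum F.shift g n (F.coding fun _ => i) = n * g (F.constPoint i) := by
  induction n with
  | zero => simp
  | succ n ih =>
    rw [birkhoffSum_coding_succ, ih, constPoint]
    push_cast
    ring

theorem point_mem_interior (x : ℕ → Fin (d + 2)) : F.point x ∈ interior F.X := by
  rw [F.point_eq]
  exact F.mapsTo_interior _ (F.point_mem_X _)

theorem comp_continuousOn (n : ℕ) (ω : Fin n → Fin (d + 2)) : ContinuousOn (F.comp n ω) F.X := by
  obtain ⟨K, _, hK⟩ := F.exists_lipschitz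
  exact (F.comp_lipschitz hK n ω).continuousOn

theorem comp_strictMono (n : ℕ) (ω : Fin n → Fin (d + 2)) : StrictMonoOn (F.comp n ω) F.X := by
  induction n with
  | zero => exact strictMono_id.strictMonoOn _
  | succ n ih => exact (F.strictMono _).comp (ih _) (F.comp_mapsTo n _)

theorem ordConnected_X : F.X.OrdConnected := F.isConnected_X.isPreconnected.ordConnected

theorem ordConnected_image (n : ℕ) (ω : Fin n → Fin (d + 2)) :
    (F.comp n ω '' F.X).OrdConnected :=
  (F.isConnected_X.isPreconnected.image _ (F.comp_continuousOn n ω)).ordConnected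

theorem point_eq_comp (n : ℕ) (x : ℕ → Fin (d + 2)) :
    F.point x = F.comp n (pre x n) (F.point fun j => x (j + n)) := by
  induction n generalizing x with
  | zero => rfl
  | succ n ih =>
    rw [comp_pre_succ, F.point_eq, Function.comp_apply, ih]
    simp only [add_assoc]

theorem pre_eq_iff {x y : ℕ → Fin (d + 2)} {n : ℕ} :
    pre x n = pre y n ↔ ∀ j < n, x j = y j :=
  ⟨fun h j hj => congrFun h ⟨j, hj⟩, fun h => funext fun j => h j j.2⟩

/-- Strong separation determines the first letter; injectivity of that generator then strips it off.
-/
theorem eq_of_point_mem {n : ℕ} {x y : ℕ → Fin (d + 2)}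
    (h : F.point y ∈ F.comp n (pre x n) '' F.X) : ∀ j < n, y j = x j := by
  induction n generalizing x y with
  | zero => simp
  | succ n ih =>
    rw [comp_pre_succ, image_comp] at h
    obtain ⟨p, hp, hpy⟩ := h
    have hpX : p ∈ F.X := by
      obtain ⟨q, hq, rfl⟩ := hp
      exact F.comp_mapsTo _ _ hq
    have h0 : x 0 = y 0 := by
      by_contra hne
      exact Set.disjoint_left.1 (F.separation _ _ hne) ⟨p, hpX, hpy⟩
        ⟨_, F.point_mem_X _, (F.point_eq y).symm⟩
    rw [F.point_eq y, h0] at hpy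
    have := (F.strictMono _).injOn hpX (F.point_mem_X _) hpy
    rw [this] at hp
    intro j hj
    cases j with
    | zero => exact h0.symm
    | succ j => exact ih hp j (by omega)

/-- Points of the same `n`-th level interval are exponentially close. -/
theorem exists_dist_le : ∃ K D : ℝ, 0 ≤ K ∧ K < 1 ∧ 0 ≤ D ∧
    ∀ n (ω : Fin n → Fin (d + 2)), ∀ u ∈ F.comp n ω '' F.X, ∀ v ∈ F.comp n ω '' F.X,
      |u - v| ≤ K ^ n * D := by
  obtain ⟨K, hK1, hK⟩ := F.exists_lipschitz
  refine ⟨K, Metric.diam F.X, K.2, by exact_mod_cast hK1, Metric.diam_nonneg, ?_⟩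
  rintro n ω _ ⟨p, hp, rfl⟩ _ ⟨q, hq, rfl⟩
  rw [← Real.dist_eq]
  refine ((F.comp_lipschitz hK n _).dist_le_mul p hp q hq).trans ?_
  rw [NNReal.coe_pow]
  gcongr
  exact Metric.dist_le_diam_of_mem F.isCompact_X.isBounded hp hq

theorem tendsto_of_mem (x : ℕ → Fin (d + 2)) (u : ℕ → ℝ)
    (hu : ∀ n, u n ∈ F.comp n (pre x n) '' F.X) : Tendsto u atTop (𝓝 (F.point x)) := by
  obtain ⟨K, D, hK0, hK1, _, hKD⟩ := F.exists_dist_le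
  rw [tendsto_iff_dist_tendsto_zero]
  have hlim : Tendsto (fun n : ℕ => K ^ n * D) atTop (𝓝 (0 * D)) :=
    (tendsto_pow_atTop_nhds_zero_of_lt_one hK0 hK1).mul_const _
  rw [zero_mul] at hlim
  exact squeeze_zero (fun _ => dist_nonneg)
    (fun n => hKD n _ _ (hu n) _ (F.point_mem x n)) hlim

theorem continuous_point : Continuous F.point := by
  obtain ⟨K, D, hK0, hK1, _, hKD⟩ := F.exists_dist_le
  rw [continuous_iff_continuousAt]
  intro x
  rw [ContinuousAt, Metric.tendsto_nhds]
  intro ε hε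
  have hlim : Tendsto (fun n : ℕ => K ^ n * D) atTop (𝓝 (0 * D)) :=
    (tendsto_pow_atTop_nhds_zero_of_lt_one hK0 hK1).mul_const _
  rw [zero_mul] at hlim
  obtain ⟨n, hn⟩ := (hlim.eventually (gt_mem_nhds hε)).exists
  have hev : ∀ᶠ y in 𝓝 x, ∀ j ∈ Finset.range n, y j = x j := by
    rw [Finset.eventually_all]
    intro j _
    exact (continuous_apply j).continuousAt.eventually
      ((isOpen_discrete {x j}).mem_nhds rfl)
  filter_upwards [hev] with y hy
  have hpre : pre y n = pre x n := pre_eq_iff.2 fun j hj => hy j (Finset.mem_range.2 hj)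
  exact (hKD n _ _ (hpre ▸ F.point_mem y n) _ (F.point_mem x n)).trans_lt hn

/-! ### Bounded distortion and the geometric potential -/

/-- The derivatives of the generators on `interior X`: continuity, positivity and the
mean value comparison with Hölder error. -/
theorem letter_distortion (a : Fin (d + 2)) : ContinuousOn (deriv (F.f a)) (interior F.X) ∧
    (∀ p ∈ interior F.X, 0 < deriv (F.f a) p) ∧
    ∀ ε : ℝ≥0, 0 < ε → ∀ Y : Set ℝ, IsOpen Y → F.X ⊆ Y → ∀ g : ℝ → ℝ, EqOn g (F.f a) F.X →
      DifferentiableOn ℝ g Y → (∀ y ∈ Y, deriv g y ≠ 0) →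
      (∃ C : ℝ≥0, HolderOnWith C ε (deriv g) Y) →
      ∃ C : ℝ, 0 ≤ C ∧ ∀ p ∈ interior F.X, ∀ r, ∀ u ∈ F.X, ∀ v ∈ F.X, |u - p| ≤ r → |v - p| ≤ r →
        |F.f a u - F.f a v| ≤ Real.exp (C * r ^ (ε : ℝ)) * deriv (F.f a) p * |u - v| ∧
        deriv (F.f a) p * |u - v| ≤ Real.exp (C * r ^ (ε : ℝ)) * |F.f a u - F.f a v| := by
  -- Used for two continuations: one taken from `F.holder` for the first two claims, and the given
  -- one for the third, so that one `ε` can later serve all letters.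
  have main : ∀ ε : ℝ≥0, 0 < ε → ∀ Y : Set ℝ, IsOpen Y → F.X ⊆ Y → ∀ g : ℝ → ℝ,
      EqOn g (F.f a) F.X → DifferentiableOn ℝ g Y → (∀ y ∈ Y, deriv g y ≠ 0) →
      (∃ C : ℝ≥0, HolderOnWith C ε (deriv g) Y) →
      (EqOn (deriv g) (deriv (F.f a)) (interior F.X) ∧
      ContinuousOn (deriv g) Y ∧ ∀ p ∈ interior F.X, 0 < deriv g p) := by
    rintro ε hε Y hY hXY g hg hdiff hne ⟨C, hC⟩
    have heq : EqOn (deriv g) (deriv (F.f a)) (interior F.X) := fun p hp =>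
      Filter.EventuallyEq.deriv_eq (by
        filter_upwards [isOpen_interior.mem_nhds hp] with q hq using hg (interior_subset hq))
    refine ⟨heq, hC.continuousOn hε, fun p hp => ?_⟩
    have hmono : MonotoneOn g F.X := ((F.strictMono a).congr hg.symm).monotoneOn
    have h1 : 0 ≤ derivWithin g F.X p := hmono.derivWithin_nonneg
    rw [derivWithin_of_mem_nhds (mem_interior_iff_mem_nhds.1 hp)] at h1
    exact h1.lt_of_ne (hne p (hXY (interior_subset hp))).symm
  obtain ⟨ε, hε, Y, hY, -, hXY, hall⟩ := F.holder
  obtain ⟨g, hg, -, -, hdiff, hne, hC⟩ := hall a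
  obtain ⟨heq, hcont, hpos⟩ := main ε hε Y hY hXY g hg hdiff hne hC
  refine ⟨(hcont.mono (interior_subset.trans hXY)).congr heq.symm,
    fun p hp => heq hp ▸ hpos p hp, ?_⟩
  clear heq hcont hpos hC hne hdiff hg g hall hXY hY hε
  rintro ε hε Y hY hXY g hg hdiff hne ⟨C, hC⟩
  obtain ⟨heq, hcont, hpos⟩ := main ε hε Y hY hXY g hg hdiff hne ⟨C, hC⟩
  -- The positive minimum `m` of the derivative's absolute value on `X` turns the additive Hölder
  -- error into a multiplicative one.
  obtain ⟨q, hq, hmin⟩ := F.isCompact_X.exists_isMinOn F.isConnected_X.nonempty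
    (hcont.mono hXY).abs
  set m := |deriv g q| with hm
  have hm0 : 0 < m := abs_pos.2 (hne q (hXY hq))
  have hle : ∀ p ∈ interior F.X, m ≤ deriv g p := fun p hp => by
    have := isMinOn_iff.1 hmin p (interior_subset hp)
    rwa [abs_of_pos (hpos p hp)] at this
  have hcmp : ∀ p ∈ interior F.X, ∀ t ∈ interior F.X, ∀ r, |t - p| ≤ r →
      deriv g t ≤ Real.exp (C / m * r ^ (ε : ℝ)) * deriv g p := by
    intro p hp t ht r hr
    have h1 := hC.dist_le (hXY (interior_subset ht)) (hXY (interior_subset hp))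
    rw [Real.dist_eq, Real.dist_eq] at h1
    have h2 : |t - p| ^ (ε : ℝ) ≤ r ^ (ε : ℝ) := by gcongr
    have hr0 : 0 ≤ r ^ (ε : ℝ) := Real.rpow_nonneg ((abs_nonneg _).trans hr) _
    have h3 : deriv g t ≤ deriv g p + C * r ^ (ε : ℝ) := by
      have := le_abs_self (deriv g t - deriv g p)
      have : (C : ℝ) * |t - p| ^ (ε : ℝ) ≤ C * r ^ (ε : ℝ) := by gcongr
      linarith
    calc deriv g t ≤ deriv g p + C * r ^ (ε : ℝ) := h3
      _ = deriv g p + C / m * r ^ (ε : ℝ) * m := by field_simp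
      _ ≤ deriv g p + C / m * r ^ (ε : ℝ) * deriv g p := by gcongr; exact hle p hp
      _ = (C / m * r ^ (ε : ℝ) + 1) * deriv g p := by ring
      _ ≤ _ := mul_le_mul_of_nonneg_right (Real.add_one_le_exp _) (hpos p hp).le
  refine ⟨C / m, by positivity, fun p hp r u hu v hv hur hvr => ?_⟩
  have key : ∀ u ∈ F.X, ∀ v ∈ F.X, |u - p| ≤ r → |v - p| ≤ r → u < v →
      |F.f a u - F.f a v| ≤ Real.exp (C / m * r ^ (ε : ℝ)) * deriv (F.f a) p * |u - v| ∧
        deriv (F.f a) p * |u - v| ≤ Real.exp (C / m * r ^ (ε : ℝ)) * |F.f a u - F.f a v| := by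
    intro u hu v hv hur hvr huv
    have hsub : Icc u v ⊆ F.X := F.ordConnected_X.out hu hv
    obtain ⟨t, ht, hts⟩ := exists_deriv_eq_slope g huv
      (hdiff.continuousOn.mono (hsub.trans hXY))
      (hdiff.mono (Ioo_subset_Icc_self.trans (hsub.trans hXY)))
    have htX : t ∈ interior F.X :=
      interior_maximal (Ioo_subset_Icc_self.trans hsub) isOpen_Ioo ht
    have htr : |t - p| ≤ r := by
      rw [abs_le] at hur hvr ⊢
      constructor <;> linarith [ht.1, ht.2]
    have hfe : |F.f a u - F.f a v| = deriv g t * |u - v| := by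
      rw [← hg hu, ← hg hv, abs_sub_comm, abs_sub_comm u v, hts, abs_of_pos (sub_pos.2 huv),
        div_mul_cancel₀ _ (sub_pos.2 huv).ne']
      apply abs_of_pos
      rw [hg hu, hg hv]
      exact sub_pos.2 (F.strictMono a hu hv huv)
    rw [hfe, ← heq hp, ← mul_assoc]
    constructor
    · gcongr
      exact hcmp p hp t htX r htr
    · gcongr
      exact hcmp t htX p hp r (by rwa [abs_sub_comm])
  rcases lt_trichotomy u v with h | h | h
  · exact key u hu v hv hur hvr h
  · simp [h]
  · have := key v hv u hu hvr hur h
    rwa [abs_sub_comm (F.f a v), abs_sub_comm v] at this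

theorem exp_geomPotential (x : ℕ → Fin (d + 2)) :
    Real.exp (F.geomPotential (F.coding x)) =
      deriv (F.f (x 0)) (F.point fun j => x (j + 1)) := by
  rw [geomPotential, word_coding, shift_coding]
  exact Real.exp_log ((F.letter_distortion _).2.1 _ (F.point_mem_interior _))

/-- Bounded distortion: `f_ω` expands distances by `exp (S_n φ)` up to a constant factor. -/
theorem distortion : ∃ B : ℝ, ∀ n (x : ℕ → Fin (d + 2)), ∀ u ∈ F.X, ∀ v ∈ F.X,
    |F.comp n (pre x n) u - F.comp n (pre x n) v| ≤
      Real.exp (B + birkhoffSum F.shift F.geomPotential n (F.coding x)) * |u - v| ∧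
    Real.exp (birkhoffSum F.shift F.geomPotential n (F.coding x) - B) * |u - v| ≤
      |F.comp n (pre x n) u - F.comp n (pre x n) v| := by
  obtain ⟨K, D, hK0, hK1, hD, hKD⟩ := F.exists_dist_le
  obtain ⟨ε, hε, Y, hY, -, hXY, hall⟩ := F.holder
  have hC : ∀ a, ∃ C : ℝ, 0 ≤ C ∧ ∀ p ∈ interior F.X, ∀ r, ∀ u ∈ F.X, ∀ v ∈ F.X,
      |u - p| ≤ r → |v - p| ≤ r →
        |F.f a u - F.f a v| ≤ Real.exp (C * r ^ (ε : ℝ)) * deriv (F.f a) p * |u - v| ∧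
        deriv (F.f a) p * |u - v| ≤ Real.exp (C * r ^ (ε : ℝ)) * |F.f a u - F.f a v| := by
    intro a
    obtain ⟨g, hg, -, -, hdiff, hne, hC⟩ := hall a
    exact (F.letter_distortion a).2.2 ε hε Y hY hXY g hg hdiff hne hC
  choose C hC0 hC using hC
  set M := ∑ a, C a
  have hM : ∀ a, C a ≤ M := fun a =>
    Finset.single_le_sum (fun b _ => hC0 b) (Finset.mem_univ a)
  -- A letter followed by `n` others acts on an interval of length at most `K ^ n * D`, so `b n`
  -- bounds its logarithmic distortion; these bounds form a geometric series.
  set b : ℕ → ℝ := fun n => M * (K ^ n * D) ^ (ε : ℝ) with hb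
  have hM0 : 0 ≤ M := Finset.sum_nonneg fun a _ => hC0 a
  have hb0 : ∀ n, 0 ≤ b n := fun n => by positivity
  have hbs : Summable b := by
    have h1 : b = fun n => (M * D ^ (ε : ℝ)) * (K ^ (ε : ℝ)) ^ n := by
      funext n
      rw [hb]
      simp only
      rw [Real.mul_rpow (by positivity) hD, ← Real.rpow_natCast, ← Real.rpow_natCast,
        ← Real.rpow_mul hK0, ← Real.rpow_mul hK0, mul_comm (n : ℝ)]
      ring
    rw [h1]
    exact (summable_geometric_of_lt_one (by positivity)
      (Real.rpow_lt_one hK0 hK1 (by exact_mod_cast hε))).mul_left _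
  have main : ∀ n (x : ℕ → Fin (d + 2)), ∀ u ∈ F.X, ∀ v ∈ F.X,
      |F.comp n (pre x n) u - F.comp n (pre x n) v| ≤
        Real.exp (∑ j ∈ Finset.range n, b j +
          birkhoffSum F.shift F.geomPotential n (F.coding x)) * |u - v| ∧
      Real.exp (birkhoffSum F.shift F.geomPotential n (F.coding x) -
        ∑ j ∈ Finset.range n, b j) * |u - v| ≤
        |F.comp n (pre x n) u - F.comp n (pre x n) v| := by
    intro n
    induction n with
    | zero => intro x u _ v _; simp [comp]
    | succ n ih =>
      intro x u hu v hv
      obtain ⟨ih1, ih2⟩ := ih (fun j => x (j + 1)) u hu v hv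
      rw [comp_pre_succ, Function.comp_apply, Function.comp_apply, birkhoffSum_coding_succ,
        Finset.sum_range_succ]
      set y : ℕ → Fin (d + 2) := fun j => x (j + 1)
      set u' := F.comp n (pre y n) u
      set v' := F.comp n (pre y n) v
      set S := birkhoffSum F.shift F.geomPotential n (F.coding y)
      obtain ⟨h1, h2⟩ := hC (x 0) _ (F.point_mem_interior y) (K ^ n * D) u'
        (F.comp_mapsTo n _ hu) v' (F.comp_mapsTo n _ hv)
        (hKD n _ _ ⟨u, hu, rfl⟩ _ (F.point_mem y n)) (hKD n _ _ ⟨v, hv, rfl⟩ _ (F.point_mem y n))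
      rw [← F.exp_geomPotential x] at h1 h2
      have hE : Real.exp (C (x 0) * (K ^ n * D) ^ (ε : ℝ)) ≤ Real.exp (b n) :=
        Real.exp_le_exp.2 (mul_le_mul_of_nonneg_right (hM _) (by positivity))
      set E := Real.exp (C (x 0) * (K ^ n * D) ^ (ε : ℝ))
      set s := ∑ j ∈ Finset.range n, b j
      set φ := F.geomPotential (F.coding x)
      constructor
      · calc _ ≤ E * Real.exp φ * |u' - v'| := h1
          _ ≤ Real.exp (b n) * Real.exp φ * (Real.exp (s + S) * |u - v|) := by gcongr
          _ = _ := by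
            rw [← mul_assoc, ← Real.exp_add, ← Real.exp_add]
            congr 2
            ring
      · have h3 : Real.exp φ * |u' - v'| ≤ Real.exp (b n) * |F.f (x 0) u' - F.f (x 0) v'| :=
          h2.trans (by gcongr)
        calc _ = Real.exp (- b n) * (Real.exp φ * (Real.exp (S - s) * |u - v|)) := by
              rw [← mul_assoc, ← mul_assoc, ← Real.exp_add, ← Real.exp_add]
              congr 2
              ring
          _ ≤ Real.exp (- b n) * (Real.exp φ * |u' - v'|) := by gcongr
          _ ≤ Real.exp (- b n) * (Real.exp (b n) * |F.f (x 0) u' - F.f (x 0) v'|) := by gcongr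
          _ = _ := by rw [← mul_assoc, ← Real.exp_add]; simp
  refine ⟨∑' n, b n, fun n x u hu v hv => ?_⟩
  have hs : ∑ j ∈ Finset.range n, b j ≤ ∑' n, b n := hbs.sum_le_tsum _ fun j _ => hb0 j
  obtain ⟨h1, h2⟩ := main n x u hu v hv
  exact ⟨h1.trans (by gcongr), le_trans (by gcongr) h2⟩

/-- The first letter ranges over a discrete space, and for a fixed letter the potential is
continuous in the tail. -/
theorem continuous_geomPotential_coding :
    Continuous fun x : ℕ → Fin (d + 2) => F.geomPotential (F.coding x) := by
  have h : ∀ a, Continuous fun x : ℕ → Fin (d + 2) =>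
      Real.log (deriv (F.f a) (F.point fun j => x (j + 1))) := by
    intro a
    refine Continuous.log ?_ fun x =>
      ((F.letter_distortion a).2.1 _ (F.point_mem_interior _)).ne'
    exact (F.letter_distortion a).1.comp_continuous
      (F.continuous_point.comp (by fun_prop)) fun x => F.point_mem_interior _
  have h2 : Continuous fun p : Fin (d + 2) × (ℕ → Fin (d + 2)) =>
      Real.log (deriv (F.f p.1) (F.point fun j => p.2 (j + 1))) :=
    continuous_prod_of_discrete_left.2 h
  have h3 : Continuous fun x : ℕ → Fin (d + 2) => (x 0, x) := by fun_prop
  convert h2.comp h3 using 2 with x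
  rw [geomPotential, word_coding, shift_coding]
  rfl

theorem continuous_coding : Continuous F.coding :=
  F.continuous_point.subtype_mk _

/-! ### Order and gaps, treated for both sides at once by the sign `s` -/

/-- One of the two ends of `X`: a sign `s`, the endpoint `e` of `X` minimizing `s * u`, and the
letter `i` of the first level interval next to it. -/
structure Side where
  s : ℝ
  e : ℝ
  i : Fin (d + 2)
  sign : s = 1 ∨ s = -1
  mem : e ∈ F.X
  le : ∀ u ∈ F.X, s * e ≤ s * u
  lt : ∀ a, a ≠ i → ∀ u ∈ F.f i '' F.X, ∀ v ∈ F.f a '' F.X, s * u < s * v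

theorem exists_side_left : ∃ T : F.Side, T.i = 0 ∧ T.s = 1 :=
  ⟨⟨1, sInf F.X, 0, Or.inl rfl, F.isCompact_X.sInf_mem F.isConnected_X.nonempty,
    fun u hu => by simpa using csInf_le F.isCompact_X.bddBelow hu,
    fun a ha u hu v hv => by simpa using F.leftmost a ha u hu v hv⟩, rfl, rfl⟩

theorem exists_side_right : ∃ T : F.Side, T.i = 1 ∧ T.s = -1 :=
  ⟨⟨-1, sSup F.X, 1, Or.inr rfl, F.isCompact_X.sSup_mem F.isConnected_X.nonempty,
    fun u hu => by simpa using le_csSup F.isCompact_X.bddAbove hu,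
    fun a ha u hu v hv => by simpa using F.rightmost a ha u hu v hv⟩, rfl, rfl⟩

/-- The union of the points of the `n`-th level cylinder around `point x`. -/
def level (n : ℕ) (x : ℕ → Fin (d + 2)) : Set ℝ := F.point '' {y | ∀ j < n, y j = x j}

theorem image_cylinder (n : ℕ) (x : ℕ → Fin (d + 2)) :
    Subtype.val '' F.cylinder (pre x n) = F.level n x := by
  ext u
  constructor
  · rintro ⟨η, hη, rfl⟩
    refine ⟨F.word η, fun j hj => hη ⟨j, hj⟩, ?_⟩
    exact congrArg Subtype.val (F.coding.apply_symm_apply η)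
  · rintro ⟨y, hy, rfl⟩
    refine ⟨F.coding y, fun j => ?_, rfl⟩
    rw [word_coding]
    exact hy j j.2

namespace Side

variable {F} (T : F.Side)

theorem map_lt {f : ℝ → ℝ} (hf : StrictMonoOn f F.X) {u v : ℝ} (hu : u ∈ F.X) (hv : v ∈ F.X)
    (h : T.s * u < T.s * v) : T.s * f u < T.s * f v := by
  rcases T.sign with hs | hs <;> rw [hs] at h ⊢
  · have := hf hu hv (by linarith)
    linarith
  · have := hf hv hu (by linarith)
    linarith

theorem map_le {f : ℝ → ℝ} (hf : StrictMonoOn f F.X) {u v : ℝ} (hu : u ∈ F.X) (hv : v ∈ F.X)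
    (h : T.s * u ≤ T.s * v) : T.s * f u ≤ T.s * f v := by
  rcases T.sign with hs | hs <;> rw [hs] at h ⊢
  · have := hf.monotoneOn hu hv (by linarith)
    linarith
  · have := hf.monotoneOn hv hu (by linarith)
    linarith

theorem mem_of_between {t : Set ℝ} (ht : t.OrdConnected) {u v w : ℝ} (hu : u ∈ t) (hv : v ∈ t)
    (h1 : T.s * u ≤ T.s * w) (h2 : T.s * w ≤ T.s * v) : w ∈ t := by
  rcases T.sign with hs | hs <;> rw [hs] at h1 h2
  · exact ht.out hu hv ⟨by linarith, by linarith⟩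
  · exact ht.out hv hu ⟨by linarith, by linarith⟩

theorem sub_le_abs (u v : ℝ) : T.s * u - T.s * v ≤ |u - v| := by
  rcases T.sign with hs | hs <;> rw [hs]
  · have := le_abs_self (u - v)
    linarith
  · have := neg_le_abs (u - v)
    linarith

theorem lt_of_mem_interior {p : ℝ} (hp : p ∈ interior F.X) : T.s * T.e < T.s * p := by
  obtain ⟨r, hr, hsub⟩ := Metric.mem_nhds_iff.1 (mem_interior_iff_mem_nhds.1 hp)
  have hmem : p - T.s * (r / 2) ∈ F.X := by
    apply hsub
    rw [Metric.mem_ball, Real.dist_eq]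
    rcases T.sign with hs | hs <;> rw [hs] <;> rw [abs_lt] <;> constructor <;> linarith
  have := T.le _ hmem
  rcases T.sign with hs | hs <;> rw [hs] at this ⊢ <;> linarith

/-- The inequality is strict because limit points lie in the interior of `X`. -/
theorem endpoint_lt_point (n : ℕ) {x y : ℕ → Fin (d + 2)} (h : ∀ j < n, y j = x j) :
    T.s * F.comp n (pre x n) T.e < T.s * F.point y := by
  rw [F.point_eq_comp n y, pre_eq_iff.2 h]
  exact T.map_lt (F.comp_strictMono n _) T.mem (F.point_mem_X _)
    (T.lt_of_mem_interior (F.point_mem_interior _))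

/-- At the first difference the letter `T.i` is extreme, and the common prefix acts by increasing
maps. -/
theorem point_lt_point {m : ℕ} {x y : ℕ → Fin (d + 2)} (h : ∀ j < m, y j = x j) (hy : y m = T.i)
    (hx : x m ≠ T.i) : T.s * F.point y < T.s * F.point x := by
  induction m generalizing x y with
  | zero =>
    refine T.lt _ hx _ ?_ _ ⟨_, F.point_mem_X _, (F.point_eq x).symm⟩
    rw [← hy]
    exact ⟨_, F.point_mem_X _, (F.point_eq y).symm⟩
  | succ m ih =>
    rw [F.point_eq x, F.point_eq y, h 0 (by omega)]
    exact T.map_lt (F.strictMono _) (F.point_mem_X _) (F.point_mem_X _)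
      (ih (fun j hj => h (j + 1) (by omega)) hy hx)

/-- Where `x` already carries the extreme letter, a first disagreement would put `y` on the wrong
side of `x`. -/
theorem agree_of_le {n k : ℕ} {x y : ℕ → Fin (d + 2)} (h : ∀ j < n, y j = x j)
    (hx : ∀ j < k, x (n + j) = T.i) (hle : T.s * F.point y ≤ T.s * F.point x) :
    ∀ j < n + k, y j = x j := by
  induction k with
  | zero => simpa using h
  | succ k ih =>
    have ih' := ih fun j hj => hx j (by omega)
    intro j hj
    rcases (show j < n + k ∨ j = n + k by omega) with hj' | rfl
    · exact ih' j hj'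
    · by_contra hne
      rw [hx k (by omega)] at hne
      exact absurd (T.point_lt_point (fun j hj => (ih' j hj).symm) (hx k (by omega)) hne)
        (not_lt.2 hle)

/-- Every first level interval other than the extreme one has a gap on the side `T`. -/
theorem exists_gap : ∃ t : ℝ, ∀ b, b ≠ T.i → ∃ q ∈ F.X,
    T.s * q + Real.exp (-t) ≤ T.s * F.f b T.e ∧
    ∀ a, a ≠ b → ∀ u ∈ F.f a '' F.X, T.s * q ≤ T.s * u → T.s * F.f b T.e < T.s * u := by
  have h : ∀ b, ∃ t : ℝ, b ≠ T.i → ∃ q ∈ F.X,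
      T.s * q + Real.exp (-t) ≤ T.s * F.f b T.e ∧
      ∀ a, a ≠ b → ∀ u ∈ F.f a '' F.X, T.s * q ≤ T.s * u → T.s * F.f b T.e < T.s * u := by
    intro b
    have hev : ∀ᶠ p in 𝓝 (F.f b T.e), p ∈ F.X ∧ ∀ a, a ≠ b → p ∉ F.f a '' F.X := by
      have hX : ∀ᶠ p in 𝓝 (F.f b T.e), p ∈ F.X :=
        mem_interior_iff_mem_nhds.1 (F.mapsTo_interior b T.mem)
      refine hX.and ?_
      rw [Filter.eventually_all]
      intro a
      by_cases hab : a = b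
      · simp [hab]
      obtain ⟨K, _, hK⟩ := F.exists_lipschitz
      have hcl : IsClosed (F.f a '' F.X) :=
        (F.isCompact_X.image_of_continuousOn (hK a).continuousOn).isClosed
      have := hcl.isOpen_compl.mem_nhds
        (Set.disjoint_left.1 (F.separation b a (Ne.symm hab)) ⟨T.e, T.mem, rfl⟩)
      filter_upwards [this] with p hp _ using hp
    obtain ⟨r, hr, hsub⟩ := Metric.eventually_nhds_iff.1 hev
    -- The ball of radius `r` about `F.f b T.e` lies in `X` and misses the other first level
    -- intervals; `q` is placed `r / 2` beyond the end, and `exp (-t) = r / 2`.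
    refine ⟨-Real.log (r / 2), fun _ => ⟨F.f b T.e - T.s * (r / 2), (hsub ?_).1, ?_, ?_⟩⟩
    · rw [Real.dist_eq]
      rcases T.sign with hs | hs <;> rw [hs] <;> rw [abs_lt] <;> constructor <;> linarith
    · rw [neg_neg, Real.exp_log (by positivity)]
      rcases T.sign with hs | hs <;> rw [hs] <;> linarith
    · intro a hab u hu hqu
      by_contra! hle
      refine (hsub (y := u) ?_).2 a hab hu
      rw [Real.dist_eq]
      rcases T.sign with hs | hs <;> rw [hs] at hqu hle <;> rw [abs_lt] <;>
        constructor <;> linarith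
  choose t ht using h
  obtain ⟨M, hM⟩ := Finite.exists_le t
  refine ⟨M, fun b hb => ?_⟩
  obtain ⟨q, hq, h1, h2⟩ := ht b hb
  refine ⟨q, hq, le_trans ?_ h1, h2⟩
  have : Real.exp (-M) ≤ Real.exp (-t b) := Real.exp_le_exp.2 (neg_le_neg (hM b))
  linarith

/-- Points close to `point x` on the side `T` are separated from it at a high level. -/
theorem eventually_exists_level (x : ℕ → Fin (d + 2)) (m : ℕ) :
    ∀ᶠ η in 𝓝 (F.point x), T.s * η < T.s * F.point x →
      ∃ n ≥ m, η ∈ F.comp n (pre x n) '' F.X ∧ T.s * η ≤ T.s * F.comp (n + 1) (pre x (n + 1)) T.e := by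
  have hev : ∀ᶠ η in 𝓝 (F.point x), ∀ j ∈ Finset.range (m + 1),
      T.s * F.comp j (pre x j) T.e < T.s * η := by
    rw [Finset.eventually_all]
    intro j _
    have hc : ContinuousAt (fun η : ℝ => T.s * η) (F.point x) := by fun_prop
    exact hc.eventually (lt_mem_nhds (T.endpoint_lt_point j fun _ _ => rfl))
  filter_upwards [hev] with η hη hlt
  have hex : ∃ j, T.s * η ≤ T.s * F.comp j (pre x j) T.e := by
    have := (F.tendsto_of_mem x (fun j => F.comp j (pre x j) T.e)
      fun j => ⟨_, T.mem, rfl⟩).const_mul T.s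
    exact ((this.eventually (lt_mem_nhds hlt)).exists).imp fun _ h => h.le
  -- At the first level whose endpoint reaches or passes `η`, the preceding interval still contains
  -- `η`.
  classical
  have h1 := Nat.find_spec hex
  have h2 : m + 1 ≤ Nat.find hex := by
    by_contra! h
    exact absurd h1 (not_le.2 (hη _ (Finset.mem_range.2 h)))
  obtain ⟨n, hn⟩ : ∃ n, Nat.find hex = n + 1 := ⟨Nat.find hex - 1, by omega⟩
  have h3 : T.s * F.comp n (pre x n) T.e < T.s * η :=
    not_le.1 (Nat.find_min hex (m := n) (by omega))
  rw [hn] at h1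
  exact ⟨n, by omega, T.mem_of_between (F.ordConnected_image n _) ⟨_, T.mem, rfl⟩
    (F.point_mem x n) h3.le hlt.le, h1⟩

/-! ### Increments of the distribution function -/

section Mass

variable (ν : Measure ℝ) [IsProbabilityMeasure ν]

theorem abs_sub_eq {u v : ℝ} (h : u ≤ v) :
    |ν.real (Iic v) - ν.real (Iic u)| = ν.real (Ioc u v) := by
  rw [← Iic_union_Ioc_eq_Iic h, measureReal_union (Set.Iic_disjoint_Ioc le_rfl) measurableSet_Ioc,
    add_sub_cancel_left, abs_of_nonneg measureReal_nonneg]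

theorem measure_le_abs_sub {A : Set ℝ} {u v : ℝ}
    (hA : ∀ w ∈ A, T.s * u < T.s * w ∧ T.s * w < T.s * v) (huv : T.s * u ≤ T.s * v) :
    ν.real A ≤ |ν.real (Iic v) - ν.real (Iic u)| := by
  rcases T.sign with hs | hs <;> simp only [hs] at hA huv
  · rw [abs_sub_eq ν (by linarith)]
    exact measureReal_mono fun w hw => ⟨by linarith [hA w hw], by linarith [hA w hw]⟩
  · rw [abs_sub_comm, abs_sub_eq ν (by linarith)]
    exact measureReal_mono fun w hw => ⟨by linarith [hA w hw], by linarith [hA w hw]⟩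

/-- Only limit points carry mass. Non-strict bounds in the hypothesis cover the half-open interval
of either orientation. -/
theorem abs_sub_le_measure (hν : ν F.limitSetᶜ = 0) {A : Set ℝ} {u v : ℝ}
    (hA : ∀ w ∈ F.limitSet, T.s * u ≤ T.s * w → T.s * w ≤ T.s * v → w ∈ A)
    (huv : T.s * u ≤ T.s * v) :
    |ν.real (Iic v) - ν.real (Iic u)| ≤ ν.real A := by
  have h0 : ∀ t : Set ℝ, (∀ w ∈ t, T.s * u ≤ T.s * w ∧ T.s * w ≤ T.s * v) →
      ν.real t ≤ ν.real A := by
    intro t ht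
    have hsub : t ⊆ A ∪ F.limitSetᶜ := fun w hw => by
      by_cases hwL : w ∈ F.limitSet
      · exact Or.inl (hA w hwL (ht w hw).1 (ht w hw).2)
      · exact Or.inr hwL
    refine (measureReal_mono hsub).trans ((measureReal_union_le _ _).trans ?_)
    simp [Measure.real, hν]
  rcases T.sign with hs | hs <;> simp only [hs] at h0 huv
  · rw [abs_sub_eq ν (by linarith)]
    exact h0 _ fun w hw => ⟨by linarith [hw.1], by linarith [hw.2]⟩
  · rw [abs_sub_comm, abs_sub_eq ν (by linarith)]
    exact h0 _ fun w hw => ⟨by linarith [hw.2], by linarith [hw.1]⟩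

end Mass

end Side

/-! ### Gibbs bounds along words -/

theorem birkhoffSum_coding_add (g : F.limitSet → ℝ) (m n : ℕ) (x : ℕ → Fin (d + 2)) :
    birkhoffSum F.shift g (m + n) (F.coding x) =
      birkhoffSum F.shift g m (F.coding x) +
        birkhoffSum F.shift g n (F.coding fun j => x (j + m)) := by
  rw [birkhoffSum_add, shift_iterate_coding]

theorem birkhoffSum_sub_const_mul (g h : F.limitSet → ℝ) (α : ℝ) (n : ℕ) (ξ : F.limitSet) :
    birkhoffSum F.shift (fun η => g η - α * h η) n ξ =
      birkhoffSum F.shift g n ξ - α * birkhoffSum F.shift h n ξ := by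
  simp only [birkhoffSum, Finset.sum_sub_distrib, Finset.mul_sum]

/-- The Gibbs inequalities in terms of words, with a constant written as an exponential. -/
theorem IsGibbsMeasure.exists_bound {F : ConformalIFS d} {ψ : F.limitSet → ℝ} {ν : Measure ℝ}
    (hν : F.IsGibbsMeasure ψ ν) : ∃ γ : ℝ, ∀ n (x y : ℕ → Fin (d + 2)), (∀ j < n, y j = x j) →
      Real.exp (birkhoffSum F.shift ψ n (F.coding y) - γ) ≤ ν.real (F.level n x) ∧
      ν.real (F.level n x) ≤ Real.exp (γ + birkhoffSum F.shift ψ n (F.coding y)) := by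
  obtain ⟨-, -, c, hc, h⟩ := hν
  refine ⟨Real.log c, fun n x y hxy => ?_⟩
  have := h n (pre x n) (F.coding y) fun j => by
    rw [word_coding]
    exact hxy j j.2
  rw [image_cylinder] at this
  rw [sub_eq_add_neg, Real.exp_add, Real.exp_add, Real.exp_neg, Real.exp_log hc, mul_comm _ c⁻¹]
  exact this

/-- Both sums are compared with the mass of the same cylinder, so each Gibbs inequality costs one
`γ`. -/
theorem birkhoffSum_le_of_agree {F : ConformalIFS d} {ψ : F.limitSet → ℝ} {ν : Measure ℝ} {γ : ℝ}
    (hγ : ∀ n (x y : ℕ → Fin (d + 2)), (∀ j < n, y j = x j) →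
      Real.exp (birkhoffSum F.shift ψ n (F.coding y) - γ) ≤ ν.real (F.level n x) ∧
      ν.real (F.level n x) ≤ Real.exp (γ + birkhoffSum F.shift ψ n (F.coding y)))
    {n : ℕ} {x y : ℕ → Fin (d + 2)} (h : ∀ j < n, y j = x j) :
    birkhoffSum F.shift ψ n (F.coding y) ≤ 2 * γ + birkhoffSum F.shift ψ n (F.coding x) := by
  have := Real.exp_le_exp.1 ((hγ n x y h).1.trans (hγ n x x fun _ _ => rfl).2)
  linarith

/-! ### Lower and upper bounds for difference quotients -/

namespace Side

variable {F} (T : F.Side)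

/-- Difference quotients on the side `T` are large, in terms of the run of the letter `T.i`
following the first level at which the two points are separated. -/
theorem exists_le_quotient {α : ℝ} (hα : 0 < α) {ψ : F.limitSet → ℝ} {ν : Measure ℝ}
    (hν : F.IsGibbsMeasure ψ ν) : ∃ c : ℝ, ∀ (x : ℕ → Fin (d + 2)) (n k : ℕ) (η : ℝ),
      (∀ j < k, x (n + 1 + j) = T.i) → x (n + 1 + k) ≠ T.i →
      η ∈ F.comp n (pre x n) '' F.X → T.s * η ≤ T.s * F.comp (n + 1) (pre x (n + 1)) T.e →
      Real.exp (c + (birkhoffSum F.shift (fun η => ψ η - α * F.geomPotential η) (n + 1)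
        (F.coding x) + k * ψ (F.constPoint T.i))) ≤
        |ν.real (Iic (F.point x)) - ν.real (Iic η)| / |F.point x - η| ^ α := by
  obtain ⟨γ, hγ⟩ := hν.exists_bound
  have := hν.1
  obtain ⟨B, hB⟩ := F.distortion
  obtain ⟨K, D, -, -, hD, hKD⟩ := F.exists_dist_le
  obtain ⟨L, hL⟩ : ∃ L, ∀ x, L ≤ F.geomPotential (F.coding x) := by
    obtain ⟨L, hL⟩ := isCompact_univ.bddBelow_image F.continuous_geomPotential_coding.continuousOn
    exact ⟨L, fun x => hL ⟨x, mem_univ x, rfl⟩⟩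
  -- One `γ` comes from the Gibbs lower bound and two from exchanging words; `ψ (F.constPoint T.i)`
  -- pays for the extra letter of the cylinder. `B` is distortion, `D` bounds the length of `X`, and
  -- `L ≤ φ` is needed to pass from `S_n φ` to `S_{n+1} φ`.
  refine ⟨-3 * γ + ψ (F.constPoint T.i) - α * (B + D - L), ?_⟩
  rintro x n k _ hrun hend ⟨p, hp, rfl⟩ hη
  set η := F.comp n (pre x n) p
  set z : ℕ → Fin (d + 2) := fun j => if j < n + 1 then x j else T.i
  have hzx : ∀ j < n + 1, z j = x j := fun j hj => if_pos hj
  have hzs : (fun j => z (j + (n + 1))) = fun _ => T.i := by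
    funext j
    exact if_neg (by omega)
  have hlt : T.s * η < T.s * F.point x :=
    hη.trans_lt (T.endpoint_lt_point (n + 1) fun _ _ => rfl)
  have hmass : Real.exp (birkhoffSum F.shift ψ (n + 1) (F.coding x)
      + (k + 1) * ψ (F.constPoint T.i) - 3 * γ) ≤
      |ν.real (Iic (F.point x)) - ν.real (Iic η)| := by
    -- The cylinder contains `k + 1` letters `T.i`, one more than the run in `x`, so it lies
    -- strictly on the side `T` of `point x`.
    refine le_trans ?_ (T.measure_le_abs_sub ν (A := F.level (n + 1 + (k + 1)) z) ?_ hlt.le)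
    · refine le_trans ?_ (hγ (n + 1 + (k + 1)) z z fun _ _ => rfl).1
      rw [birkhoffSum_coding_add F ψ (n + 1) (k + 1) z, hzs, birkhoffSum_const]
      have := birkhoffSum_le_of_agree hγ fun j hj => (hzx j hj).symm
      push_cast
      refine Real.exp_le_exp.2 ?_
      linarith
    · rintro _ ⟨y, hy, rfl⟩
      refine ⟨hη.trans_lt (T.endpoint_lt_point (n + 1) fun j hj => ?_),
        T.point_lt_point (m := n + 1 + k) (fun j hj => ?_) ?_ hend⟩
      · rw [hy j (by omega), hzx j hj]
      · rw [hy j (by omega)]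
        by_cases hjn : j < n + 1
        · exact hzx j hjn
        · have := hrun (j - (n + 1)) (by omega)
          rw [show n + 1 + (j - (n + 1)) = j by omega] at this
          rw [this]
          exact if_neg hjn
      · rw [hy _ (by omega)]
        exact if_neg (by omega)
  have hdist : |F.point x - η| ≤ Real.exp (B + D - L +
      birkhoffSum F.shift F.geomPotential (n + 1) (F.coding x)) := by
    rw [F.point_eq_comp n x, birkhoffSum_coding_add]
    refine (hB n x _ (F.point_mem_X _) _ hp).1.trans ?_
    have h1 : |(F.point fun j => x (j + n)) - p| ≤ Real.exp D := by
      have := hKD 0 Fin.elim0 _ ⟨_, F.point_mem_X fun j => x (j + n), rfl⟩ _ ⟨p, hp, rfl⟩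
      rw [pow_zero, one_mul] at this
      exact this.trans (by linarith [Real.add_one_le_exp D])
    have h2 := hL fun j => x (j + n)
    calc _ ≤ Real.exp (B + birkhoffSum F.shift F.geomPotential n (F.coding x)) * Real.exp D := by
          gcongr
      _ ≤ _ := by
          rw [← Real.exp_add, birkhoffSum_one]
          exact Real.exp_le_exp.2 (by linarith)
  have hpos : 0 < |F.point x - η| := abs_pos.2 (sub_ne_zero.2 fun h => by
    rw [h] at hlt
    exact lt_irrefl _ hlt)
  rw [le_div_iff₀ (Real.rpow_pos_of_pos hpos _)]
  calc _ ≤ _ * Real.exp (B + D - L +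
      birkhoffSum F.shift F.geomPotential (n + 1) (F.coding x)) ^ α := by gcongr
    _ = Real.exp (birkhoffSum F.shift ψ (n + 1) (F.coding x)
      + (k + 1) * ψ (F.constPoint T.i) - 3 * γ) := by
        rw [← Real.exp_mul, ← Real.exp_add, birkhoffSum_sub_const_mul]
        congr 1
        ring
    _ ≤ _ := hmass

/-- A run of the letter `T.i` following a different letter gives a nearby point on the side `T`
with a small difference quotient. -/
theorem exists_quotient_le {α : ℝ} (hα : 0 < α) {ψ : F.limitSet → ℝ} {ν : Measure ℝ}
    (hν : F.IsGibbsMeasure ψ ν) (hφ : ∀ ξ, F.geomPotential ξ ≤ 0) :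
    ∃ c : ℝ, ∀ (x : ℕ → Fin (d + 2)) (n k : ℕ),
      x n ≠ T.i → (∀ j < k, x (n + 1 + j) = T.i) →
      ∃ η ∈ F.comp n (pre x n) '' F.X, η ≠ F.point x ∧
        |ν.real (Iic (F.point x)) - ν.real (Iic η)| / |F.point x - η| ^ α ≤
        Real.exp (c + (birkhoffSum F.shift (fun η => ψ η - α * F.geomPotential η) (n + 1)
          (F.coding x) + k * ψ (F.constPoint T.i))) := by
  obtain ⟨γ, hγ⟩ := hν.exists_bound
  have := hν.1
  obtain ⟨B, hB⟩ := F.distortion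
  obtain ⟨t, ht⟩ := T.exists_gap
  -- One `γ` is for the Gibbs upper bound and two for replacing the tail by `T.i T.i …`; `exp (-t)`
  -- is the gap width.
  refine ⟨3 * γ + α * (B + t), fun x n k hn hrun => ?_⟩
  obtain ⟨q, hq, hgap, hsep⟩ := ht _ hn
  set σx : ℕ → Fin (d + 2) := fun j => x (j + n)
  have hfe : T.s * F.f (x n) T.e ≤ T.s * F.point σx := by
    rw [F.point_eq σx]
    simp only [σx, zero_add]
    exact T.map_le (F.strictMono _) T.mem (F.point_mem_X _) (T.le _ (F.point_mem_X _))
  set η := F.comp n (pre x n) q 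
  have hqx : T.s * q < T.s * F.point σx := by
    linarith [Real.exp_pos (-t)]
  have hlt : T.s * η < T.s * F.point x := by
    rw [F.point_eq_comp n x]
    exact T.map_lt (F.comp_strictMono n _) hq (F.point_mem_X _) hqx
  have hne : η ≠ F.point x := fun h => by
    rw [h] at hlt
    exact lt_irrefl _ hlt
  refine ⟨η, ⟨q, hq, rfl⟩, hne, ?_⟩
  have hmass : |ν.real (Iic (F.point x)) - ν.real (Iic η)| ≤
      Real.exp (3 * γ + birkhoffSum F.shift ψ (n + 1) (F.coding x)
        + k * ψ (F.constPoint T.i)) := by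
    refine (T.abs_sub_le_measure ν hν.2.1 (A := F.level (n + 1 + k) x) ?_ hlt.le).trans ?_
    · intro w hw hw1 hw2
      obtain ⟨y, rfl⟩ := F.point_surjective hw
      refine ⟨y, T.agree_of_le ?_ hrun hw2, rfl⟩
      have hyn : ∀ j < n, y j = x j := F.eq_of_point_mem
        (T.mem_of_between (F.ordConnected_image n _) ⟨q, hq, rfl⟩ (F.point_mem x n) hw1 hw2)
      set σy : ℕ → Fin (d + 2) := fun j => y (j + n)
      have hpy : F.point y = F.comp n (pre x n) (F.point σy) := by
        rw [← pre_eq_iff.2 hyn]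
        exact F.point_eq_comp n y
      have hy1 : T.s * q ≤ T.s * F.point σy := by
        by_contra! h
        have := T.map_lt (F.comp_strictMono n (pre x n)) (F.point_mem_X σy) hq h
        rw [← hpy] at this
        exact absurd hw1 (not_le.2 this)
      have hy2 : T.s * F.point σy ≤ T.s * F.point σx := by
        by_contra! h
        have := T.map_lt (F.comp_strictMono n (pre x n)) (F.point_mem_X σx) (F.point_mem_X σy) h
        rw [← hpy, ← F.point_eq_comp n x] at this
        exact absurd hw2 (not_le.2 this)
      -- A different letter would, by the gap, put `σy` between the end of the interval of `x n` and
      -- `σx`, hence inside that interval, against separation.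
      have hyn1 : y n = x n := by
        by_contra hyx
        have hmem : F.point σy ∈ F.f (y n) '' F.X := by
          rw [F.point_eq σy]
          simp only [σy, zero_add]
          exact ⟨_, F.point_mem_X _, rfl⟩
        have hmemx : F.point σx ∈ F.f (x n) '' F.X := by
          rw [F.point_eq σx]
          simp only [σx, zero_add]
          exact ⟨_, F.point_mem_X _, rfl⟩
        have h1 := hsep _ hyx _ hmem hy1
        have h2 : F.point σy ∈ F.f (x n) '' F.X :=
          T.mem_of_between (F.ordConnected_image 1 fun _ => x n) ⟨_, T.mem, rfl⟩ hmemx h1.le hy2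
        exact Set.disjoint_left.1 (F.separation _ _ hyx) hmem h2
      intro j hj
      rcases (show j < n ∨ j = n by omega) with h | rfl
      · exact hyn j h
      · exact hyn1
    · refine (hγ (n + 1 + k) x x fun _ _ => rfl).2.trans ?_
      rw [birkhoffSum_coding_add]
      have h1 := birkhoffSum_le_of_agree hγ (n := k) (x := fun _ => T.i)
        (y := fun j => x (j + (n + 1))) fun j hj => by
          simpa only [add_comm j] using hrun j hj
      rw [birkhoffSum_const] at h1
      exact Real.exp_le_exp.2 (by linarith)
  have hdist : Real.exp (birkhoffSum F.shift F.geomPotential (n + 1) (F.coding x) - B - t) ≤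
      |F.point x - η| := by
    rw [birkhoffSum_coding_add, F.point_eq_comp n x]
    refine le_trans ?_ (hB n x _ (F.point_mem_X _) _ hq).2
    have h1 : Real.exp (-t) ≤ |F.point σx - q| := by
      refine le_trans ?_ (T.sub_le_abs _ _)
      linarith
    have h2 := hφ (F.coding σx)
    calc _ ≤ Real.exp (birkhoffSum F.shift F.geomPotential n (F.coding x) - B)
          * Real.exp (-t) := by
          rw [← Real.exp_add, birkhoffSum_one]
          exact Real.exp_le_exp.2 (by linarith)
      _ ≤ _ := by gcongr
  have hpos : 0 < |F.point x - η| := abs_pos.2 (sub_ne_zero.2 hne.symm)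
  rw [div_le_iff₀ (Real.rpow_pos_of_pos hpos _)]
  calc _ ≤ _ := hmass
    _ = Real.exp (3 * γ + α * (B + t) +
        (birkhoffSum F.shift (fun η => ψ η - α * F.geomPotential η) (n + 1) (F.coding x) +
          k * ψ (F.constPoint T.i))) *
        Real.exp (birkhoffSum F.shift F.geomPotential (n + 1) (F.coding x) - B - t) ^ α := by
        rw [← Real.exp_mul, ← Real.exp_add, birkhoffSum_sub_const_mul]
        congr 1
        ring
    _ ≤ _ := by gcongr

end Side

/-! ### Growth of Birkhoff sums, maximal blocks and unbounded quotients -/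

/-- The space of words is compact, so `κ` can be the minimum of `χ`. -/
theorem exists_mul_le_birkhoffSum {χ : F.limitSet → ℝ}
    (hχ : Continuous fun x : ℕ → Fin (d + 2) => χ (F.coding x)) (hpos : ∀ ξ, 0 < χ ξ) :
    ∃ κ > 0, ∀ n (x : ℕ → Fin (d + 2)), n * κ ≤ birkhoffSum F.shift χ n (F.coding x) := by
  obtain ⟨x₀, -, hx₀⟩ := isCompact_univ.exists_isMinOn univ_nonempty hχ.continuousOn
  refine ⟨χ (F.coding x₀), hpos _, fun n => ?_⟩
  induction n with
  | zero => simp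
  | succ n ih =>
    intro x
    rw [birkhoffSum_coding_succ]
    have h1 := ih fun j => x (j + 1)
    have h2 : χ (F.coding x₀) ≤ χ (F.coding x) := isMinOn_iff.1 hx₀ x (mem_univ x)
    push_cast
    linarith

theorem birkhoffSum_coding_mono {χ : F.limitSet → ℝ} (hpos : ∀ ξ, 0 < χ ξ) {m n : ℕ} (h : m ≤ n)
    (ξ : F.limitSet) : birkhoffSum F.shift χ m ξ ≤ birkhoffSum F.shift χ n ξ := by
  obtain ⟨k, rfl⟩ := Nat.exists_eq_add_of_le h
  rw [birkhoffSum_add]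
  exact le_add_of_nonneg_right (Finset.sum_nonneg fun _ _ => (hpos _).le)

/-- If long runs of the letter `i` with bounded exponent start arbitrarily far, then so do
maximal ones. -/
theorem exists_block {χ : F.limitSet → ℝ} {κ b C : ℝ} {x : ℕ → Fin (d + 2)} {i : Fin (d + 2)}
    (hκ : 0 < κ) (hb : b < 0) (hpos : ∀ ξ, 0 < χ ξ)
    (hgrow : ∀ n : ℕ, n * κ ≤ birkhoffSum F.shift χ n (F.coding x))
    (hx : ∀ m, ∃ n ≥ m, x n ≠ i)
    (h : ∀ m, ∃ n ≥ m, ∃ k : ℕ, (∀ j < k, x (n + j) = i) ∧ x (n + k) ≠ i ∧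
      birkhoffSum F.shift χ n (F.coding x) + k * b ≤ C) (m : ℕ) :
    ∃ n ≥ m, ∃ k ≥ m, F.HasBlock (F.coding x) i k n ∧
      birkhoffSum F.shift χ n (F.coding x) + k * b ≤ C := by
  obtain ⟨n₀, hn₀, hxn₀⟩ := hx m
  -- From level `M` on, a run of length at most `m` would leave the exponent above `C`.
  obtain ⟨M, hM⟩ := exists_nat_gt ((C - (m + 1 : ℕ) * b) / κ)
  obtain ⟨N, hN, k, hrun, hend, hle⟩ := h (max (n₀ + 1) M)
  have hk : m + 1 ≤ k := by
    by_contra! hlt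
    have h1 : (k : ℝ) * b ≥ (m + 1 : ℕ) * b :=
      mul_le_mul_of_nonpos_right (by exact_mod_cast hlt.le) hb.le
    have h2 : (M : ℝ) * κ ≤ N * κ := by
      gcongr
      exact (le_max_right _ _).trans hN
    rw [div_lt_iff₀ hκ] at hM
    linarith [hgrow N]
  classical
  set P : ℕ → Prop := fun n => 1 ≤ n ∧ x (n - 1) ≠ i
  have hP₀ : P (n₀ + 1) := ⟨by omega, hxn₀⟩
  have hnN : n₀ + 1 ≤ N := (le_max_left _ _).trans hN
  -- The last position up to `N` preceded by a letter other than `i`. Starting there lowers the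
  -- Birkhoff sum since `χ > 0`, and lengthens the run, which lowers the exponent further since `b <
  -- 0`.
  set N' := Nat.findGreatest P N
  have hN' : P N' := Nat.findGreatest_spec hnN hP₀
  have hle' : N' ≤ N := Nat.findGreatest_le N
  have hge : n₀ + 1 ≤ N' := Nat.le_findGreatest hnN hP₀
  refine ⟨N', by omega, N - N' + k, by omega, ⟨hN'.1, by omega, ?_, fun j hj => ?_, ?_⟩, ?_⟩
  · rw [word_coding]
    exact hN'.2
  · rw [word_coding]
    by_cases hjN : N' + j < N
    · by_contra hne
      exact Nat.findGreatest_is_greatest (P := P) (n := N) (k := N' + j + 1)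
        (by change N' < _; omega) (by omega) ⟨by omega, hne⟩
    · have := hrun (N' + j - N) (by omega)
      rwa [show N + (N' + j - N) = N' + j by omega] at this
  · rw [word_coding, show N' + (N - N' + k) = N + k by omega]
    exact hend
  · have h1 := F.birkhoffSum_coding_mono hpos hle' (F.coding x)
    have h2 : ((N - N' : ℕ) : ℝ) * b ≤ 0 := mul_nonpos_of_nonneg_of_nonpos (by positivity) hb.le
    push_cast
    linarith

theorem exists_strictMono_pair {Q : ℕ → ℕ → Prop} (h : ∀ m, ∃ n ≥ m, ∃ k ≥ m, Q n k) :
    ∃ n k : ℕ → ℕ, StrictMono n ∧ StrictMono k ∧ ∀ m, Q (n m) (k m) := by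
  choose n hn k hk hQ using h
  -- Each threshold exceeds both previously chosen values, so both sequences increase strictly.
  let r : ℕ → ℕ := fun m => Nat.rec 0 (fun _ p => max (n p) (k p) + 1) m
  refine ⟨n ∘ r, k ∘ r, strictMono_nat_of_lt_succ fun m => ?_,
    strictMono_nat_of_lt_succ fun m => ?_, fun m => hQ _⟩
  · exact (Nat.lt_succ_of_le (le_max_left (n (r m)) (k (r m)))).trans_le (hn (r (m + 1)))
  · exact (Nat.lt_succ_of_le (le_max_right (n (r m)) (k (r m)))).trans_le (hk (r (m + 1)))

/-- Along a sequence of separating points the difference quotients are unbounded. -/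
theorem Side.exists_unbounded_quotient {F : ConformalIFS d} (T : F.Side) {α : ℝ} (hα : 0 < α)
    {ψ : F.limitSet → ℝ} {ν : Measure ℝ} (hν : F.IsGibbsMeasure ψ ν) {κ : ℝ} (hκ : 0 < κ)
    {x : ℕ → Fin (d + 2)}
    (hgrow : ∀ n : ℕ, n * κ ≤
      birkhoffSum F.shift (fun η => ψ η - α * F.geomPotential η) n (F.coding x))
    (hx : ∀ m, ∃ n ≥ m, x n ≠ T.i) :
    ∃ η : ℕ → ℝ, Tendsto η atTop (𝓝[≠] (F.point x)) ∧
      Tendsto (fun m => |ν.real (Iic (F.point x)) - ν.real (Iic (η m))| / |F.point x - η m| ^ α)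
        atTop atTop := by
  obtain ⟨c, hc⟩ := T.exists_le_quotient hα hν
  -- No run of `T.i` follows level `n + 1`, so the lower bound applies with `k = 0`.
  have hex : ∀ m, ∃ n ≥ m, x (n + 1) ≠ T.i := fun m => by
    obtain ⟨n, hn, hxn⟩ := hx (m + 1)
    exact ⟨n - 1, by omega, by rwa [Nat.sub_add_cancel (by omega)]⟩
  choose n hn hxn using hex
  have hn' : Tendsto (fun m => n m + 1) atTop atTop :=
    tendsto_atTop_mono (fun m => (hn m).trans (Nat.le_succ _)) tendsto_id
  refine ⟨fun m => F.comp (n m + 1) (pre x (n m + 1)) T.e, ?_, ?_⟩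
  · refine tendsto_nhdsWithin_iff.2 ⟨(F.tendsto_of_mem x (fun m => F.comp m (pre x m) T.e)
      fun m => ⟨_, T.mem, rfl⟩).comp hn', Eventually.of_forall fun m h => ?_⟩
    have h1 := T.endpoint_lt_point (n m + 1) (x := x) fun _ _ => rfl
    have h2 : F.comp (n m + 1) (pre x (n m + 1)) T.e = F.point x := h
    rw [h2] at h1
    exact lt_irrefl _ h1
  · refine tendsto_atTop_mono (f := fun m : ℕ => c + m * κ) (fun m => ?_)
      (tendsto_atTop_add_const_left _ _ (tendsto_natCast_atTop_atTop.atTop_mul_const hκ))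
    refine le_trans ?_ (hc x (n m) 0 _ (by simp) (hxn m)
      (F.comp_pre_antitone x _ ⟨_, T.mem, rfl⟩) le_rfl)
    refine le_trans ?_ ((le_add_of_nonneg_right zero_le_one).trans (Real.add_one_le_exp _))
    have h1 : (m : ℝ) * κ ≤ (n m + 1 : ℕ) * κ := by
      gcongr
      exact (hn m).trans (Nat.le_succ _)
    have h2 := hgrow (n m + 1)
    rw [Nat.cast_zero, zero_mul, add_zero]
    linarith

end ConformalIFS

/-! ### The equivalence -/

theorem proposition2p5 {d : ℕ} (F : ConformalIFS d) (α : ℝ) (hα : 0 < α)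
    (ψ : C(F.limitSet, ℝ)) (hHolder : ∃ C r : ℝ≥0, 0 < r ∧ HolderWith C r ψ)
    (hneg : ∀ ξ, ψ ξ < 0) (hP : F.HasPressure ψ 0)
    (hχ : ∀ ξ, α * F.geomPotential ξ < ψ ξ)
    (ν : Measure ℝ) (hν : F.IsGibbsMeasure ψ ν)
    (ξ : F.limitSet) (hξ : ξ ∉ F.endpoints) :
    ¬ HolderDerivExists α (fun u => ν.real (Set.Iic u)) ξ ↔
      ∃ i : Fin (d + 2), (i = 0 ∨ i = 1) ∧ ∃ n k : ℕ → ℕ, StrictMono n ∧ StrictMono k ∧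
        (∀ m, F.HasBlock ξ i (k m) (n m)) ∧
        ∃ C : ℝ, ∀ m,
          Real.exp (birkhoffSum F.shift (fun η => ψ η - α * F.geomPotential η) (n m) ξ
            + k m * ψ (F.constPoint i)) ≤ C := by
  obtain ⟨x, rfl⟩ := F.coding.surjective ξ
  have hcoe : ((F.coding x : F.limitSet) : ℝ) = F.point x := rfl
  have hx : ∀ i : Fin (d + 2), i = 0 ∨ i = 1 → ∀ m, ∃ n ≥ m, x n ≠ i := by
    intro i hi m
    by_contra! h
    exact hξ ⟨i, hi, m, fun k hk => by rw [F.word_coding]; exact h k hk⟩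
  have hpos : ∀ η, 0 < ψ η - α * F.geomPotential η := fun η => sub_pos.2 (hχ η)
  obtain ⟨κ, hκ, hgrow⟩ := F.exists_mul_le_birkhoffSum
    (χ := fun η => ψ η - α * F.geomPotential η)
    ((ψ.continuous.comp F.continuous_coding).sub
      (F.continuous_geomPotential_coding.const_mul α)) hpos
  rw [hcoe]
  set R : ℝ → ℝ := fun η =>
    |ν.real (Iic (F.point x)) - ν.real (Iic η)| / |F.point x - η| ^ α with hR
  constructor
  · intro hnot
    -- Otherwise the quotients tend to `∞`, which is a generalized limit.
    have hfreq : ∃ M : ℝ, ∃ᶠ η in 𝓝[≠] (F.point x), R η ≤ M := by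
      by_contra! h
      refine hnot ⟨⊤, EReal.tendsto_nhds_top_iff_real.2 fun M => ?_⟩
      filter_upwards [h M] with η hη
      exact EReal.coe_lt_coe_iff.2 hη
    obtain ⟨M, hM⟩ := hfreq
    have hside : ∃ T : F.Side, (T.i = 0 ∨ T.i = 1) ∧
        ∃ᶠ η in 𝓝 (F.point x), T.s * η < T.s * F.point x ∧ R η ≤ M := by
      rw [frequently_nhdsWithin_iff] at hM
      have : ∃ᶠ η in 𝓝 (F.point x), (η < F.point x ∧ R η ≤ M) ∨ (F.point x < η ∧ R η ≤ M) :=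
        hM.mono fun η hη => (lt_or_gt_of_ne hη.2).imp (⟨·, hη.1⟩) (⟨·, hη.1⟩)
      rcases frequently_or_distrib.1 this with h | h
      · obtain ⟨T, hi, hs⟩ := F.exists_side_left
        exact ⟨T, Or.inl hi, by simpa [hs] using h⟩
      · obtain ⟨T, hi, hs⟩ := F.exists_side_right
        exact ⟨T, Or.inr hi, by simpa [hs] using h⟩
    obtain ⟨T, hi, hT⟩ := hside
    obtain ⟨c, hc⟩ := T.exists_le_quotient hα hν
    have hruns : ∀ m, ∃ n ≥ m, ∃ k : ℕ, (∀ j < k, x (n + j) = T.i) ∧ x (n + k) ≠ T.i ∧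
        birkhoffSum F.shift (fun η => ψ η - α * F.geomPotential η) n (F.coding x)
          + k * ψ (F.constPoint T.i) ≤ M - c := by
      intro m
      obtain ⟨η, ⟨hlt, hRη⟩, hη⟩ := (hT.and_eventually (T.eventually_exists_level x m)).exists
      obtain ⟨n, hn, hmem, hle⟩ := hη hlt
      have hex : ∃ k, x (n + 1 + k) ≠ T.i := by
        obtain ⟨l, hl, hxl⟩ := hx _ hi (n + 1)
        exact ⟨l - (n + 1), by rwa [Nat.add_sub_cancel' hl]⟩
      classical
      have hrun : ∀ j < Nat.find hex, x (n + 1 + j) = T.i :=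
        fun j hj => not_not.1 (Nat.find_min hex hj)
      refine ⟨n + 1, by omega, Nat.find hex, hrun, Nat.find_spec hex, ?_⟩
      have h1 := (hc x n _ η hrun (Nat.find_spec hex) hmem hle).trans hRη
      have h2 := (le_add_of_nonneg_right zero_le_one).trans ((Real.add_one_le_exp _).trans h1)
      linarith
    obtain ⟨n, k, hn, hk, h⟩ := ConformalIFS.exists_strictMono_pair
      (F.exists_block hκ (hneg _) hpos (fun n => hgrow n x) (hx _ hi) hruns)
    exact ⟨T.i, hi, n, k, hn, hk, fun m => (h m).1, Real.exp (M - c),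
      fun m => Real.exp_le_exp.2 (h m).2⟩
  · rintro ⟨i, hi, n, k, hn, -, hblock, C, hC⟩ ⟨l, hl⟩
    obtain ⟨T, rfl⟩ : ∃ T : F.Side, T.i = i := by
      rcases hi with rfl | rfl
      · exact F.exists_side_left.imp fun _ h => h.1
      · exact F.exists_side_right.imp fun _ h => h.1
    -- Negativity follows from `αφ < ψ < 0`.
    have hφ : ∀ η, F.geomPotential η ≤ 0 := fun η =>
      (neg_of_mul_neg_right ((hχ η).trans (hneg η)) hα.le).le
    obtain ⟨c, hc⟩ := T.exists_quotient_le hα hν hφ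
    -- Codes start at index `0`, so the letter preceding a block at level `n m` has index `n m - 1`.
    have hη : ∀ m, ∃ η ∈ F.comp (n m - 1) (ConformalIFS.pre x (n m - 1)) '' F.X, η ≠ F.point x ∧
        R η ≤ Real.exp c * C := by
      intro m
      obtain ⟨h1, -, hne, hrun, -⟩ := hblock m
      rw [F.word_coding] at hne hrun
      have hnm : n m - 1 + 1 = n m := Nat.sub_add_cancel h1
      obtain ⟨η, hmem, hηne, hle⟩ := hc x (n m - 1) (k m) hne (by rwa [hnm])
      refine ⟨η, hmem, hηne, hle.trans ?_⟩
      rw [hnm, Real.exp_add]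
      gcongr
      exact hC m
    choose η hmem hne hle using hη
    have hnt : Tendsto (fun m => n m - 1) atTop atTop :=
      (tendsto_sub_atTop_nat 1).comp hn.tendsto_atTop
    have hηt : Tendsto η atTop (𝓝[≠] (F.point x)) := by
      refine tendsto_nhdsWithin_iff.2 ⟨?_, Eventually.of_forall hne⟩
      obtain ⟨K, D, hK0, hK1, -, hKD⟩ := F.exists_dist_le
      rw [tendsto_iff_dist_tendsto_zero]
      have hlim : Tendsto (fun j : ℕ => K ^ j * D) atTop (𝓝 (0 * D)) :=
        (tendsto_pow_atTop_nhds_zero_of_lt_one hK0 hK1).mul_const _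
      rw [zero_mul] at hlim
      exact squeeze_zero (fun _ => dist_nonneg)
        (fun m => hKD _ _ _ (hmem m) _ (F.point_mem x _)) (hlim.comp hnt)
    have hl1 : l ≤ ((Real.exp c * C : ℝ) : EReal) :=
      le_of_tendsto' (hl.comp hηt) fun m => EReal.coe_le_coe_iff.2 (hle m)
    -- Along `η` the limit is at most `exp c * C`; along `θ` it must exceed this by at least `1`.
    obtain ⟨θ, hθ, hθt⟩ := T.exists_unbounded_quotient hα hν hκ (fun n => hgrow n x) (hx _ hi)
    have hl2 : ((Real.exp c * C + 1 : ℝ) : EReal) ≤ l :=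
      ge_of_tendsto (hl.comp hθ) ((hθt.eventually_ge_atTop _).mono fun m hm =>
        EReal.coe_le_coe_iff.2 hm)
    have := EReal.coe_le_coe_iff.1 (hl2.trans hl1)
    linarith
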